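/- Let $\mathbb{S}^3$ be the topological group of unit quaternions and $H=\{(g,g): g\in\mathbb{S}^3\}$ the diagonal subgroup of $\mathbb{S}^3\times\mathbb{S}^3$. For integers $k,l$ let $P_{k,l}\to\mathbb{S}^4$ be the principal $\mathbb{S}^3\times\mathbb{S}^3$-bundle with clutching map $\mathbb{S}^3\to\mathbb{S}^3\times\mathbb{S}^3$, $q\mapsto(q^k,q^{-l})$. (That is, $P_{k,l}$ is glued from the trivial bundles over the complements of the two poles of $\mathbb{S}^4$, the transition function being left multiplication by $(q^k,q^{-l})$, where $q\in\mathbb{S}^3$ is the image of the base point under the radial retraction of the twice punctured sphere to the equator; the group acts by right translations of the fibres.) Let $M_{k,l}=P_{k,l}/H$ be the orbit space of $H$. If $kl\neq 0$ and the principal $H$-bundle $P_{k,l}\to P_{k,l}/H=M_{k,l}$ is trivial, i.e. there is an $H$-equivariant homeomorphism $P_{k,l}\cong M_{k,l}\times H$ over $M_{k,l}$, then $k+l\neq 0$ and $\frac{k}{k+l}$ is an integer. -/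

import Mathlib

open Set Topology

noncomputable section

/-- The Lie group `S³` of unit quaternions, with Mathlib's topology and group structure. -/
abbrev S3 : Type := Metric.sphere (0 : Quaternion ℝ) 1

/-- The sphere `S⁴`, as the unit sphere of the Euclidean space `ℍ ⊕ ℝ ≅ ℝ⁵`. -/
abbrev S4 : Type := Metric.sphere (0 : WithLp 2 (Quaternion ℝ × ℝ)) 1

namespace S4

/-- The complements of the south pole `(0, -1)` (index `true`) and of the north pole `(0, 1)`
(index `false`). -/
def chart : Bool → Set S4
  | true => {x | x.1.snd ≠ -1}
  | false => {x | x.1.snd ≠ 1}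

open Classical in
/-- The retraction `(v, t) ↦ v / ‖v‖` of `S⁴` minus the two poles onto the equator `S³`; the value
at the poles is irrelevant. -/
def toEquator (x : S4) : S3 :=
  if h : x.1.fst = 0 then 1 else ⟨‖x.1.fst‖⁻¹ • x.1.fst, by
    simp [norm_smul, h]⟩

theorem norm_sq_add (x : S4) : ‖x.1.fst‖ ^ 2 + x.1.snd ^ 2 = 1 := by
  have h := WithLp.prod_norm_sq_eq_of_L2 x.1
  have h1 : ‖x.1‖ = 1 := by simp
  rw [h1, Real.norm_eq_abs, sq_abs] at h
  linarith

theorem fst_ne_zero {x : S4} (h1 : x ∈ chart true) (h2 : x ∈ chart false) : x.1.fst ≠ 0 := by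
  intro h
  have := norm_sq_add x
  rw [h] at this
  have h3 : (x.1.snd - 1) * (x.1.snd + 1) = 0 := by
    rw [norm_zero] at this
    linarith
  rcases mul_eq_zero.1 h3 with h4 | h4
  · exact h2 (by linarith)
  · exact h1 (by linarith)

theorem isOpen_chart (i : Bool) : IsOpen (chart i) := by
  have hc : Continuous fun x : S4 => x.1.snd := by fun_prop
  cases i
  · exact isOpen_ne_fun hc continuous_const
  · exact isOpen_ne_fun hc continuous_const

theorem continuousOn_toEquator : ContinuousOn toEquator (chart true ∩ chart false) := by
  rw [continuousOn_iff_continuous_domRestrict, Topology.IsInducing.subtypeVal.continuous_iff]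
  have hf : Continuous fun x : ↥(chart true ∩ chart false) => x.1.1.fst := by fun_prop
  have : Continuous fun x : ↥(chart true ∩ chart false) => ‖x.1.1.fst‖⁻¹ • x.1.1.fst :=
    (hf.norm.inv₀ fun x => norm_ne_zero_iff.2 (fst_ne_zero x.2.1 x.2.2)).smul hf
  refine this.congr fun x => ?_
  simp [toEquator, fst_ne_zero x.2.1 x.2.2]

end S4

section Clutching

variable {G : Type} [Group G] [TopologicalSpace G] [IsTopologicalGroup G]

/-- Transition functions of the bundle over `S⁴` with clutching map `f : S³ → G`: on the overlap
of the two charts, passing from the northern to the southern one is `f (v / ‖v‖)`. -/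
def clutchingTransition (f : C(S3, G)) : Bool → Bool → S4 → G
  | true, false, x => f x.toEquator
  | false, true, x => (f x.toEquator)⁻¹
  | _, _, _ => 1

/-- The principal `G`-bundle over `S⁴` with clutching map `f : S³ → G` (equivalently, the bundle
classified by the class of `f` under `[S⁴, BG] = [S³, G]`), as the fibre bundle with fibre `G` that
is glued from two trivial ones by left translations. -/
def clutchingCore (f : C(S3, G)) : FiberBundleCore Bool S4 G where
  baseSet := S4.chart
  isOpen_baseSet := S4.isOpen_chart
  indexAt x := decide (0 ≤ x.1.snd)
  mem_baseSet_at x := by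
    by_cases h : 0 ≤ x.1.snd
    · simp only [h, decide_true, S4.chart, mem_ofPred_eq]
      intro h'
      linarith
    · simp only [h, decide_false, S4.chart, mem_ofPred_eq]
      intro h'
      linarith
  coordChange i j x a := clutchingTransition f i j x * a
  coordChange_self i x _ a := by cases i <;> simp [clutchingTransition]
  continuousOn_coordChange i j := by
    have h : ContinuousOn (fun x : S4 => f x.toEquator) (S4.chart true ∩ S4.chart false) :=
      f.continuous.comp_continuousOn S4.continuousOn_toEquator
    have key : ContinuousOn (clutchingTransition f i j) (S4.chart i ∩ S4.chart j) := by
      cases i <;> cases j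
      · exact continuousOn_const
      · rw [inter_comm]
        exact h.inv
      · exact h
      · exact continuousOn_const
    exact (key.comp continuousOn_fst fun p hp => hp.1).mul continuousOn_snd
  coordChange_comp i j k x _ a := by
    cases i <;> cases j <;> cases k <;> simp [clutchingTransition]

/-- The total space of the principal `G`-bundle over `S⁴` with clutching map `f`. -/
abbrev ClutchingBundle (f : C(S3, G)) : Type := (clutchingCore f).TotalSpace

/-- The principal right action of `G`: right translation in the fibres. The transition functions
are left translations, so the formula is the same in both charts. -/
instance clutchingAction (f : C(S3, G)) : MulAction Gᵐᵒᵖ (ClutchingBundle f) where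
  smul g p := ⟨p.1, ((show G from p.2) * g.unop : G)⟩
  one_smul p := by
    change (⟨p.1, ((show G from p.2) * 1 : G)⟩ : ClutchingBundle f) = p
    rw [mul_one]
  mul_smul g h p := by
    change (⟨p.1, ((show G from p.2) * (h.unop * g.unop) : G)⟩ : ClutchingBundle f) =
      ⟨p.1, ((show G from p.2) * h.unop * g.unop : G)⟩
    rw [mul_assoc]

end Clutching

/-- Let the topological group `G` act on `P` from the right, let `H ≤ G` be a subgroup, and let
`π : P → M` be the projection of a principal
`H`-bundle. The bundle is trivial if there is an `H`-equivariant homeomorphism `P ≅ M × H` over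
`M`, where `H` acts on `M × H` by right translation of the second factor. -/
def IsTrivialPrincipal {G : Type} [Group G] [TopologicalSpace G] (H : Subgroup G)
    {P M : Type} [TopologicalSpace P] [TopologicalSpace M] [MulAction Gᵐᵒᵖ P] (π : P → M) : Prop :=
  ∃ e : P ≃ₜ M × H, (∀ p : P, (e p).1 = π p) ∧
    ∀ (p : P) (h : H), (e (MulOpposite.op (h : G) • p)).2 = (e p).2 * h

/-- The map `S³ → S³ × S³`, `q ↦ (q ^ k, q ^ (-l))`. -/
def powerClutching (k l : ℤ) : C(S3, S3 × S3) where
  toFun q := (q ^ k, q ^ (-l))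
  continuous_toFun := (continuous_zpow k).prodMk (continuous_zpow (-l))

/-- `P_{k,l}`, the principal `S³ × S³`-bundle over `S⁴` classified by `q ↦ (q ^ k, q ^ (-l))`. -/
abbrev PBundle (k l : ℤ) : Type := ClutchingBundle (powerClutching k l)

/-- The diagonal subgroup `H` of `S³ × S³`. -/
def diagonalS3 : Subgroup (S3 × S3) := ((MonoidHom.id S3).prod (MonoidHom.id S3)).range

/-- `M_{k,l} = P_{k,l}/H`, the space of `H`-orbits with the quotient topology. -/
abbrev MSpace (k l : ℤ) : Type := MulAction.orbitRel.Quotient diagonalS3.op (PBundle k l)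

/-- The projection `P_{k,l} → P_{k,l}/H = M_{k,l}` of the principal `H`-bundle. -/
def projM (k l : ℤ) : PBundle k l → MSpace k l := Quotient.mk _

end

/-! A trivialisation of `P → M` yields a continuous `F : P → S³` with `F (p·(g, g)) = F p * g`. The
clutching map `q ↦ (q^k, q^(-l))`, placed in a fibre, is null-homotopic in `P`
(`nullhomotopic_of_clutching`). Since `(q^k, q^(-l)) = (q^(k+l), 1) · (q^(-l), q^(-l))`, applying
`F` shows that `q ↦ φ (q^(k+l)) * q^(-l)` is null-homotopic, where `φ a` is the value of `F` at the
fibre point `(a, 1)`. Taking degrees gives `(k + l) deg φ = l` (`dvd_of_nullhomotopic`). As `l ≠ 0`,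
also `k + l ≠ 0`, and `k / (k + l) = 1 - deg φ`.

The degree is built by hand for maps `ℝ³ → S³` equal to `1` outside a ball. Five labels on `S³`
replace such a map, on a fine lattice, by a simplicial map to the boundary of the 4-simplex;
`meshDegree` counts with sign the simplices labelled `0, 1, 2, 3`. Homotopy invariance
(`meshDegree_eq_of_homotopy`), additivity (`meshDegree_mul`) and the value `-1` on `wrap` hold for
all fine meshes. Independence of the mesh is never needed, because all identities are compared at
one common `N`. -/

/-! ### The label cocycle and its sums over cubes. -/

/-- The alternating integral cochain on the labels `0, …, 4` that counts the simplices labelled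
`0, 1, 2, 3`, with sign. -/
def labelCochain (a b c d : Fin 5) : ℤ :=
  (Matrix.of fun i j : Fin 4 => if (![a, b, c, d] : Fin 4 → Fin 5) i = j.castSucc
    then (1 : ℤ) else 0).det

/-- The alternating sum is the expansion, along a first column of ones, of a 5×5 determinant. If a
label is missing, two of the five labels agree, and so do two rows. -/
theorem labelCochain_cocycle (a b c d e : Fin 5)
    (h : ¬ Function.Surjective (![a, b, c, d, e] : Fin 5 → Fin 5)) :
    labelCochain b c d e - labelCochain a c d e + labelCochain a b d e - labelCochain a b c e
      + labelCochain a b c d = 0 := by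
  rw [← Finite.injective_iff_surjective] at h
  simp only [Function.Injective, not_forall] at h
  obtain ⟨i, j, hij, hne⟩ := h
  set M : Matrix (Fin 5) (Fin 5) ℤ := Matrix.of fun i j =>
    Fin.cases 1 (fun k : Fin 4 => if (![a, b, c, d, e] : Fin 5 → Fin 5) i = k.castSucc
      then (1 : ℤ) else 0) j with hM
  have h0 : M.det = 0 := Matrix.det_zero_of_row_eq hne (by
    funext k
    simp [hM, hij])
  rw [Matrix.det_succ_column_zero, Fin.sum_univ_five] at h0
  have hs (r : Fin 5) (p q s t : Fin 5)
      (hp : ∀ i, (![a, b, c, d, e] : Fin 5 → Fin 5) (r.succAbove i) = ![p, q, s, t] i) :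
      (M.submatrix r.succAbove Fin.succ).det = labelCochain p q s t := by
    rw [labelCochain]
    congr 1
    ext i j
    simp only [hM, Matrix.submatrix_apply, Matrix.of_apply, Fin.cases_succ, hp]
  rw [hs 0 b c d e (by intro i; fin_cases i <;> rfl), hs 1 a c d e (by intro i; fin_cases i <;> rfl),
    hs 2 a b d e (by intro i; fin_cases i <;> rfl), hs 3 a b c e (by intro i; fin_cases i <;> rfl),
    hs 4 a b c d (by intro i; fin_cases i <;> rfl)] at h0
  simp only [hM, Matrix.of_apply, Fin.cases_zero] at h0
  simp at h0
  linear_combination h0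

theorem labelCochain_four : labelCochain 4 4 4 4 = 0 := by decide

/-- The sum of `labelCochain` over the six simplices of the standard triangulation of the unit
cube, whose vertices are labelled by `w`. -/
def cubeCount (w : ℤ → ℤ → ℤ → Fin 5) : ℤ :=
  labelCochain (w 0 0 0) (w 1 0 0) (w 1 1 0) (w 1 1 1)
    - labelCochain (w 0 0 0) (w 1 0 0) (w 1 0 1) (w 1 1 1)
    - labelCochain (w 0 0 0) (w 0 1 0) (w 1 1 0) (w 1 1 1)
    + labelCochain (w 0 0 0) (w 0 1 0) (w 0 1 1) (w 1 1 1)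
    + labelCochain (w 0 0 0) (w 0 0 1) (w 1 0 1) (w 1 1 1)
    - labelCochain (w 0 0 0) (w 0 0 1) (w 0 1 1) (w 1 1 1)

theorem cubeCount_congr {w w' : ℤ → ℤ → ℤ → Fin 5}
    (h : ∀ i ∈ Icc (0 : ℤ) 1, ∀ j ∈ Icc (0 : ℤ) 1, ∀ k ∈ Icc (0 : ℤ) 1, w i j k = w' i j k) :
    cubeCount w = cubeCount w' := by
  have h0 : (0 : ℤ) ∈ Icc (0 : ℤ) 1 := by simp
  have h1 : (1 : ℤ) ∈ Icc (0 : ℤ) 1 := by simp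
  simp only [cubeCount, h _ h0 _ h0 _ h0, h _ h0 _ h0 _ h1, h _ h0 _ h1 _ h0, h _ h0 _ h1 _ h1,
    h _ h1 _ h0 _ h0, h _ h1 _ h0 _ h1, h _ h1 _ h1 _ h0, h _ h1 _ h1 _ h1]

theorem cubeCount_eq_zero {w : ℤ → ℤ → ℤ → Fin 5}
    (h : ∀ i ∈ Icc (0 : ℤ) 1, ∀ j ∈ Icc (0 : ℤ) 1, ∀ k ∈ Icc (0 : ℤ) 1, w i j k = 4) :
    cubeCount w = 0 := by
  rw [cubeCount_congr (w' := fun _ _ _ => 4) h]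
  simp [cubeCount, labelCochain_four]

/-- The signed sum of `cubeCount` over the facets of a four-dimensional cube vanishes if the labels
of its vertices are not all of `0, …, 4`. -/
theorem cubeCount_boundary (W : ℤ → ℤ → ℤ → ℤ → Fin 5) (m : Fin 5)
    (h : ∀ t ∈ Icc (0 : ℤ) 1, ∀ i ∈ Icc (0 : ℤ) 1, ∀ j ∈ Icc (0 : ℤ) 1, ∀ k ∈ Icc (0 : ℤ) 1,
      W t i j k ≠ m) :
    cubeCount (W 1) - cubeCount (W 0) =
      (cubeCount (fun t j k => W t 1 j k) - cubeCount (fun t j k => W t 0 j k))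
      - (cubeCount (fun t i k => W t i 1 k) - cubeCount (fun t i k => W t i 0 k))
      + (cubeCount (fun t i j => W t i j 1) - cubeCount (fun t i j => W t i j 0)) := by
  have h0 : (0 : ℤ) ∈ Icc (0 : ℤ) 1 := by simp
  have h1 : (1 : ℤ) ∈ Icc (0 : ℤ) 1 := by simp
  have key (a b c d e : Fin 5) (ha : a ≠ m) (hb : b ≠ m) (hc : c ≠ m) (hd : d ≠ m) (he : e ≠ m) :
      labelCochain b c d e - labelCochain a c d e + labelCochain a b d e - labelCochain a b c e
      + labelCochain a b c d = 0 := by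
    apply labelCochain_cocycle
    intro hs
    obtain ⟨i, hi⟩ := hs m
    fin_cases i
    · exact ha hi
    · exact hb hi
    · exact hc hi
    · exact hd hi
    · exact he hi
  have n0 := h 0 h0 0 h0 0 h0 0 h0
  have n1 := h 1 h1 1 h1 1 h1 1 h1
  simp only [cubeCount]
  -- One cocycle relation for each of the 24 simplices of the standard triangulation of the 4-cube,
  -- signed by its permutation of the axes. Faces interior to the cube cancel in pairs.
  linear_combination 
    key _ _ _ _ _ n0 (h 1 h1 0 h0 0 h0 0 h0) (h 1 h1 1 h1 0 h0 0 h0) (h 1 h1 1 h1 1 h1 0 h0) n1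
    - key _ _ _ _ _ n0 (h 1 h1 0 h0 0 h0 0 h0) (h 1 h1 1 h1 0 h0 0 h0) (h 1 h1 1 h1 0 h0 1 h1) n1
    - key _ _ _ _ _ n0 (h 1 h1 0 h0 0 h0 0 h0) (h 1 h1 0 h0 1 h1 0 h0) (h 1 h1 1 h1 1 h1 0 h0) n1
    + key _ _ _ _ _ n0 (h 1 h1 0 h0 0 h0 0 h0) (h 1 h1 0 h0 1 h1 0 h0) (h 1 h1 0 h0 1 h1 1 h1) n1
    + key _ _ _ _ _ n0 (h 1 h1 0 h0 0 h0 0 h0) (h 1 h1 0 h0 0 h0 1 h1) (h 1 h1 1 h1 0 h0 1 h1) n1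
    - key _ _ _ _ _ n0 (h 1 h1 0 h0 0 h0 0 h0) (h 1 h1 0 h0 0 h0 1 h1) (h 1 h1 0 h0 1 h1 1 h1) n1
    - key _ _ _ _ _ n0 (h 0 h0 1 h1 0 h0 0 h0) (h 1 h1 1 h1 0 h0 0 h0) (h 1 h1 1 h1 1 h1 0 h0) n1
    + key _ _ _ _ _ n0 (h 0 h0 1 h1 0 h0 0 h0) (h 1 h1 1 h1 0 h0 0 h0) (h 1 h1 1 h1 0 h0 1 h1) n1
    + key _ _ _ _ _ n0 (h 0 h0 1 h1 0 h0 0 h0) (h 0 h0 1 h1 1 h1 0 h0) (h 1 h1 1 h1 1 h1 0 h0) n1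
    - key _ _ _ _ _ n0 (h 0 h0 1 h1 0 h0 0 h0) (h 0 h0 1 h1 1 h1 0 h0) (h 0 h0 1 h1 1 h1 1 h1) n1
    - key _ _ _ _ _ n0 (h 0 h0 1 h1 0 h0 0 h0) (h 0 h0 1 h1 0 h0 1 h1) (h 1 h1 1 h1 0 h0 1 h1) n1
    + key _ _ _ _ _ n0 (h 0 h0 1 h1 0 h0 0 h0) (h 0 h0 1 h1 0 h0 1 h1) (h 0 h0 1 h1 1 h1 1 h1) n1
    + key _ _ _ _ _ n0 (h 0 h0 0 h0 1 h1 0 h0) (h 1 h1 0 h0 1 h1 0 h0) (h 1 h1 1 h1 1 h1 0 h0) n1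
    - key _ _ _ _ _ n0 (h 0 h0 0 h0 1 h1 0 h0) (h 1 h1 0 h0 1 h1 0 h0) (h 1 h1 0 h0 1 h1 1 h1) n1
    - key _ _ _ _ _ n0 (h 0 h0 0 h0 1 h1 0 h0) (h 0 h0 1 h1 1 h1 0 h0) (h 1 h1 1 h1 1 h1 0 h0) n1
    + key _ _ _ _ _ n0 (h 0 h0 0 h0 1 h1 0 h0) (h 0 h0 1 h1 1 h1 0 h0) (h 0 h0 1 h1 1 h1 1 h1) n1
    + key _ _ _ _ _ n0 (h 0 h0 0 h0 1 h1 0 h0) (h 0 h0 0 h0 1 h1 1 h1) (h 1 h1 0 h0 1 h1 1 h1) n1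
    - key _ _ _ _ _ n0 (h 0 h0 0 h0 1 h1 0 h0) (h 0 h0 0 h0 1 h1 1 h1) (h 0 h0 1 h1 1 h1 1 h1) n1
    - key _ _ _ _ _ n0 (h 0 h0 0 h0 0 h0 1 h1) (h 1 h1 0 h0 0 h0 1 h1) (h 1 h1 1 h1 0 h0 1 h1) n1
    + key _ _ _ _ _ n0 (h 0 h0 0 h0 0 h0 1 h1) (h 1 h1 0 h0 0 h0 1 h1) (h 1 h1 0 h0 1 h1 1 h1) n1
    + key _ _ _ _ _ n0 (h 0 h0 0 h0 0 h0 1 h1) (h 0 h0 1 h1 0 h0 1 h1) (h 1 h1 1 h1 0 h0 1 h1) n1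
    - key _ _ _ _ _ n0 (h 0 h0 0 h0 0 h0 1 h1) (h 0 h0 1 h1 0 h0 1 h1) (h 0 h0 1 h1 1 h1 1 h1) n1
    - key _ _ _ _ _ n0 (h 0 h0 0 h0 0 h0 1 h1) (h 0 h0 0 h0 1 h1 1 h1) (h 1 h1 0 h0 1 h1 1 h1) n1
    + key _ _ _ _ _ n0 (h 0 h0 0 h0 0 h0 1 h1) (h 0 h0 0 h0 1 h1 1 h1) (h 0 h0 1 h1 1 h1 1 h1) n1

theorem labelCochain_eq_zero {a b c d : Fin 5} (j : Fin 4) (ha : a ≠ j.castSucc)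
    (hb : b ≠ j.castSucc) (hc : c ≠ j.castSucc) (hd : d ≠ j.castSucc) :
    labelCochain a b c d = 0 := by
  refine Matrix.det_eq_zero_of_column_eq_zero j fun i => ?_
  rw [Matrix.of_apply, if_neg]
  fin_cases i
  · exact ha
  · exact hb
  · exact hc
  · exact hd

theorem cubeCount_eq_zero_of_ne {w : ℤ → ℤ → ℤ → Fin 5} (m : Fin 4)
    (h : ∀ i ∈ Icc (0 : ℤ) 1, ∀ j ∈ Icc (0 : ℤ) 1, ∀ k ∈ Icc (0 : ℤ) 1, w i j k ≠ m.castSucc) :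
    cubeCount w = 0 := by
  have h0 : (0 : ℤ) ∈ Icc (0 : ℤ) 1 := by simp
  have h1 : (1 : ℤ) ∈ Icc (0 : ℤ) 1 := by simp
  have n0 := h 0 h0 0 h0 0 h0
  have n1 := h 1 h1 1 h1 1 h1
  rw [cubeCount, labelCochain_eq_zero m n0 (h 1 h1 0 h0 0 h0) (h 1 h1 1 h1 0 h0) n1,
    labelCochain_eq_zero m n0 (h 1 h1 0 h0 0 h0) (h 1 h1 0 h0 1 h1) n1,
    labelCochain_eq_zero m n0 (h 0 h0 1 h1 0 h0) (h 1 h1 1 h1 0 h0) n1,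
    labelCochain_eq_zero m n0 (h 0 h0 1 h1 0 h0) (h 0 h0 1 h1 1 h1) n1,
    labelCochain_eq_zero m n0 (h 0 h0 0 h0 1 h1) (h 1 h1 0 h0 1 h1) n1,
    labelCochain_eq_zero m n0 (h 0 h0 0 h0 1 h1) (h 0 h0 1 h1 1 h1) n1]
  simp

/-! ### Signed counts over the lattice. -/

/-- The sum of `cubeCount` over all cubes of the lattice `ℤ³`. -/
noncomputable def gridCount (w : ℤ → ℤ → ℤ → Fin 5) : ℤ :=
  ∑ᶠ v : ℤ × ℤ × ℤ, cubeCount fun i j k => w (v.1 + i) (v.2.1 + j) (v.2.2 + k)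

/-- The labelling `w` of `ℤ³` is `4` outside of the cube of radius `R`. -/
def IsTrivialOutside (R : ℤ) (w : ℤ → ℤ → ℤ → Fin 5) : Prop :=
  ∀ x y z : ℤ, (R < |x| ∨ R < |y| ∨ R < |z|) → w x y z = 4

theorem finite_support_of_abs_le {F : ℤ × ℤ × ℤ → ℤ} (R : ℤ)
    (h : ∀ x y z : ℤ, (R < |x| ∨ R < |y| ∨ R < |z|) → F (x, y, z) = 0) :
    F.support.Finite := by
  refine (Set.finite_Icc ((-R, -R, -R) : ℤ × ℤ × ℤ) (R, R, R)).subset fun v hv => ?_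
  obtain ⟨x, y, z⟩ := v
  by_contra hn
  refine hv (h x y z ?_)
  by_contra! h'
  obtain ⟨h1, h2, h3⟩ := h'
  rw [abs_le] at h1 h2 h3
  exact hn ⟨⟨h1.1, h2.1, h3.1⟩, ⟨h1.2, h2.2, h3.2⟩⟩

theorem IsTrivialOutside.finite_support {R : ℤ} {w : ℤ → ℤ → ℤ → Fin 5}
    (h : IsTrivialOutside R w) :
    (Function.support fun v : ℤ × ℤ × ℤ =>
      cubeCount fun i j k => w (v.1 + i) (v.2.1 + j) (v.2.2 + k)).Finite := by
  -- The corners of a cube lie up to one step away from its base vertex, hence `R + 1`.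
  refine finite_support_of_abs_le (R + 1) fun x y z hv => cubeCount_eq_zero ?_
  rintro i ⟨hi, hi'⟩ j ⟨hj, hj'⟩ k ⟨hk, hk'⟩
  apply h
  simp only [lt_abs] at hv ⊢
  omega

theorem finsum_translate_sub {F : ℤ × ℤ × ℤ → ℤ} (hF : F.support.Finite) (a : ℤ × ℤ × ℤ) :
    ∑ᶠ v, (F (v + a) - F v) = 0 := by
  have h1 : (Function.support fun v => F (v + a)).Finite :=
    hF.preimage (f := fun v => v + a) (add_left_injective a).injOn
  rw [finsum_sub_distrib h1 hF]
  exact sub_eq_zero.2 (finsum_comp_equiv (Equiv.addRight a) (f := F))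

theorem finite_support_translate_sub {F : ℤ × ℤ × ℤ → ℤ} (hF : F.support.Finite)
    (a : ℤ × ℤ × ℤ) : (Function.support fun v => F (v + a) - F v).Finite := by
  have h1 : (Function.support fun v => F (v + a)).Finite :=
    hF.preimage (f := fun v => v + a) (add_left_injective a).injOn
  exact (h1.union hF).subset (Function.support_sub _ _)

/-- The two labellings are the bottom and the top of a layer of 4-cubes, each missing a label. The
signed count over the boundary of each 4-cube vanishes, and the lateral facets, shared by
neighbours, cancel in the sum over the lattice. -/
theorem gridCount_eq_of_close {R : ℤ} {w w' : ℤ → ℤ → ℤ → Fin 5} (hw : IsTrivialOutside R w)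
    (hw' : IsTrivialOutside R w')
    (h : ∀ x y z : ℤ, ∃ m, ∀ i ∈ Icc (0 : ℤ) 1, ∀ j ∈ Icc (0 : ℤ) 1, ∀ k ∈ Icc (0 : ℤ) 1,
      w (x + i) (y + j) (z + k) ≠ m ∧ w' (x + i) (y + j) (z + k) ≠ m) :
    gridCount w' = gridCount w := by
  set W : ℤ → ℤ → ℤ → ℤ → Fin 5 := fun t => if t = 0 then w else w' with hW
  have hWo (t : ℤ) : IsTrivialOutside R (W t) := by
    simp only [hW]
    split_ifs
    exacts [hw, hw']
  set F₁ : ℤ × ℤ × ℤ → ℤ := fun v => cubeCount fun t j k => W t v.1 (v.2.1 + j) (v.2.2 + k)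
  set F₂ : ℤ × ℤ × ℤ → ℤ := fun v => cubeCount fun t i k => W t (v.1 + i) v.2.1 (v.2.2 + k)
  set F₃ : ℤ × ℤ × ℤ → ℤ := fun v => cubeCount fun t i j => W t (v.1 + i) (v.2.1 + j) v.2.2
  have f₁ : F₁.support.Finite := by
    refine finite_support_of_abs_le (R + 1) fun x y z hv => cubeCount_eq_zero ?_
    rintro t - j ⟨hj, hj'⟩ k ⟨hk, hk'⟩
    apply hWo t
    simp only [lt_abs] at hv ⊢
    omega
  have f₂ : F₂.support.Finite := by
    refine finite_support_of_abs_le (R + 1) fun x y z hv => cubeCount_eq_zero ?_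
    rintro t - j ⟨hj, hj'⟩ k ⟨hk, hk'⟩
    apply hWo t
    simp only [lt_abs] at hv ⊢
    omega
  have f₃ : F₃.support.Finite := by
    refine finite_support_of_abs_le (R + 1) fun x y z hv => cubeCount_eq_zero ?_
    rintro t - j ⟨hj, hj'⟩ k ⟨hk, hk'⟩
    apply hWo t
    simp only [lt_abs] at hv ⊢
    omega
  rw [← sub_eq_zero, gridCount, gridCount, ← finsum_sub_distrib hw'.finite_support
    hw.finite_support]
  have key (v : ℤ × ℤ × ℤ) : (cubeCount fun i j k => w' (v.1 + i) (v.2.1 + j) (v.2.2 + k))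
      - (cubeCount fun i j k => w (v.1 + i) (v.2.1 + j) (v.2.2 + k)) =
      (F₁ (v + (1, 0, 0)) - F₁ v) - (F₂ (v + (0, 1, 0)) - F₂ v)
        + (F₃ (v + (0, 0, 1)) - F₃ v) := by
    obtain ⟨x, y, z⟩ := v
    obtain ⟨m, hm⟩ := h x y z
    have := cubeCount_boundary (fun t i j k => W t (x + i) (y + j) (z + k)) m (by
      intro t _ i hi j hj k hk
      by_cases ht : t = 0
      · simpa [hW, ht] using (hm i hi j hj k hk).1
      · simpa [hW, ht] using (hm i hi j hj k hk).2)
    simpa [hW, F₁, F₂, F₃] using this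
  rw [finsum_congr key, finsum_add_distrib, finsum_sub_distrib, finsum_translate_sub f₁,
    finsum_translate_sub f₂, finsum_translate_sub f₃]
  · simp
  · exact finite_support_translate_sub f₁ _
  · exact finite_support_translate_sub f₂ _
  · exact ((finite_support_translate_sub f₁ (1, 0, 0)).union
      (finite_support_translate_sub f₂ (0, 1, 0))).subset (Function.support_sub _ _)
  · exact finite_support_translate_sub f₃ _

theorem gridCount_translate (w : ℤ → ℤ → ℤ → Fin 5) (a : ℤ) :
    gridCount (fun x y z => w (x - a) y z) = gridCount w := by
  rw [gridCount, gridCount, ← finsum_comp_equiv (Equiv.addRight ((a, 0, 0) : ℤ × ℤ × ℤ))]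
  refine finsum_congr fun v => ?_
  simp only [Equiv.coe_addRight, Prod.fst_add, Prod.snd_add, add_zero]
  congr 1
  ext i j k
  congr 2
  ring

theorem gridCount_eq_add {R : ℤ} {w w₁ w₂ : ℤ → ℤ → ℤ → Fin 5} (h₁ : IsTrivialOutside R w₁)
    (h₂ : IsTrivialOutside R w₂)
    (h : ∀ x y z : ℤ,
      (∀ i ∈ Icc (0 : ℤ) 1, ∀ j ∈ Icc (0 : ℤ) 1, ∀ k ∈ Icc (0 : ℤ) 1,
        w₁ (x + i) (y + j) (z + k) = 4 ∧
          w (x + i) (y + j) (z + k) = w₂ (x + i) (y + j) (z + k)) ∨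
      (∀ i ∈ Icc (0 : ℤ) 1, ∀ j ∈ Icc (0 : ℤ) 1, ∀ k ∈ Icc (0 : ℤ) 1,
        w₂ (x + i) (y + j) (z + k) = 4 ∧
          w (x + i) (y + j) (z + k) = w₁ (x + i) (y + j) (z + k))) :
    gridCount w = gridCount w₁ + gridCount w₂ := by
  rw [gridCount, gridCount, gridCount, ← finsum_add_distrib h₁.finite_support h₂.finite_support]
  refine finsum_congr fun v => ?_
  obtain ⟨x, y, z⟩ := v
  rcases h x y z with h | h
  · rw [cubeCount_eq_zero fun i hi j hj k hk => (h i hi j hj k hk).1, zero_add]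
    exact cubeCount_congr fun i hi j hj k hk => (h i hi j hj k hk).2
  · rw [cubeCount_eq_zero (w := fun i j k => w₂ (x + i) (y + j) (z + k))
      fun i hi j hj k hk => (h i hi j hj k hk).1, add_zero]
    exact cubeCount_congr fun i hi j hj k hk => (h i hi j hj k hk).2

/-! ### The labelling of the sphere. -/

namespace S3

open Classical in
/-- A labelling of `S³` such that the five labels do not all occur on a small set. -/
noncomputable def label (q : S3) : Fin 5 :=
  if 0 < q.1.re then 4 else if 0 < q.1.imI then 0 else if 0 < q.1.imJ then 1
    else if 0 < q.1.imK then 2 else 3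

theorem label_one : label 1 = 4 :=
  if_pos (by simp [Quaternion.re_one])

theorem sq_sum_eq_one (q : S3) : q.1.re ^ 2 + q.1.imI ^ 2 + q.1.imJ ^ 2 + q.1.imK ^ 2 = 1 := by
  have h : ‖q.1‖ = 1 := by simp
  rw [← Quaternion.normSq_def', Quaternion.normSq_eq_norm_mul_self, h, one_mul]

theorem abs_coord_sub_le (a b : S3) :
    |a.1.re - b.1.re| ≤ dist a b ∧ |a.1.imI - b.1.imI| ≤ dist a b ∧
      |a.1.imJ - b.1.imJ| ≤ dist a b ∧ |a.1.imK - b.1.imK| ≤ dist a b := by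
  rw [Subtype.dist_eq, dist_eq_norm]
  have h := Quaternion.normSq_eq_norm_mul_self (a.1 - b.1)
  rw [Quaternion.normSq_def'] at h
  simp only [Quaternion.re_sub, Quaternion.imI_sub, Quaternion.imJ_sub, Quaternion.imK_sub] at h
  refine ⟨?_, ?_, ?_, ?_⟩ <;> refine abs_le_of_sq_le_sq ?_ (norm_nonneg _) <;>
    linarith [sq_nonneg (a.1.re - b.1.re), sq_nonneg (a.1.imI - b.1.imI),
      sq_nonneg (a.1.imJ - b.1.imJ), sq_nonneg (a.1.imK - b.1.imK), sq ‖a.1 - b.1‖]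

/-- A point labelled `3` has no positive coordinate, and a nearby point with each other label keeps
one of its coordinates above `-1/3`. Its squares would then sum to less than `4/9`, not to `1`. -/
theorem exists_label_ne {s : Set S3} (hs : ∀ a ∈ s, ∀ b ∈ s, dist a b < 1 / 3) :
    ∃ m, ∀ a ∈ s, label a ≠ m := by
  by_contra! h
  obtain ⟨a, ha, la⟩ := h 0
  obtain ⟨b, hb, lb⟩ := h 1
  obtain ⟨c, hc, lc⟩ := h 2
  obtain ⟨d, hd, ld⟩ := h 3
  obtain ⟨e, he, le⟩ := h 4
  have hd' : d.1.re ≤ 0 ∧ d.1.imI ≤ 0 ∧ d.1.imJ ≤ 0 ∧ d.1.imK ≤ 0 := by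
    rw [label] at ld
    split_ifs at ld <;> simp_all
  have he' : 0 < e.1.re := by
    rw [label] at le
    split_ifs at le <;> simp_all
  have ha' : 0 < a.1.imI := by
    rw [label] at la
    split_ifs at la <;> simp_all
  have hb' : 0 < b.1.imJ := by
    rw [label] at lb
    split_ifs at lb <;> simp_all
  have hc' : 0 < c.1.imK := by
    rw [label] at lc
    split_ifs at lc <;> simp_all
  have h1 := (abs_le.1 ((abs_coord_sub_le e d).1.trans (hs e he d hd).le)).2
  have h2 := (abs_le.1 ((abs_coord_sub_le a d).2.1.trans (hs a ha d hd).le)).2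
  have h3 := (abs_le.1 ((abs_coord_sub_le b d).2.2.1.trans (hs b hb d hd).le)).2
  have h4 := (abs_le.1 ((abs_coord_sub_le c d).2.2.2.trans (hs c hc d hd).le)).2
  have := sq_sum_eq_one d
  nlinarith

end S3

/-! ### The degree on a fine lattice. -/

/-- The map `f : ℝ³ → S³` is continuous and equal to `1` outside of the ball of radius `R`. -/
structure IsLoopMap (R : ℝ) (f : ℝ × ℝ × ℝ → S3) : Prop where
  continuous : Continuous f
  eq_one : ∀ x, R < ‖x‖ → f x = 1

/-- The degree of `f : ℝ³ → S³`, computed on the lattice of mesh `1 / N`. -/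
noncomputable def meshDegree (N : ℕ) (f : ℝ × ℝ × ℝ → S3) : ℤ :=
  gridCount fun x y z => S3.label (f (x / N, y / N, z / N))

theorem isTrivialOutside_label {N : ℕ} (hN : 0 < N) {R : ℝ} {f : ℝ × ℝ × ℝ → S3}
    (hf : ∀ x, R < ‖x‖ → f x = 1) :
    IsTrivialOutside (N * ⌈R⌉) fun x y z => S3.label (f (x / N, y / N, z / N)) := by
  have hN' : (0 : ℝ) < N := by exact_mod_cast hN
  have key (x : ℤ) (hx : N * ⌈R⌉ < |x|) : R < ‖(x / N : ℝ)‖ := by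
    rw [norm_div, Real.norm_natCast, lt_div_iff₀ hN', Real.norm_eq_abs]
    calc R * N ≤ ⌈R⌉ * N := by gcongr; exact Int.le_ceil R
      _ < |(x : ℝ)| := by
        rw [mul_comm]
        exact_mod_cast hx
  intro x y z h
  simp only
  rw [hf, S3.label_one]
  simp only [Prod.norm_mk, lt_sup_iff]
  exact h.imp (key x) (Or.imp (key y) (key z))

theorem norm_lattice_sub_le {N : ℕ} (x y z : ℤ) {i j k : ℤ} (hi : i ∈ Icc (0 : ℤ) 1)
    (hj : j ∈ Icc (0 : ℤ) 1) (hk : k ∈ Icc (0 : ℤ) 1) {i' j' k' : ℤ} (hi' : i' ∈ Icc (0 : ℤ) 1)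
    (hj' : j' ∈ Icc (0 : ℤ) 1) (hk' : k' ∈ Icc (0 : ℤ) 1) :
    ‖((((x + i : ℤ) : ℝ) / N, ((y + j : ℤ) : ℝ) / N, ((z + k : ℤ) : ℝ) / N) : ℝ × ℝ × ℝ)
      - (((x + i' : ℤ) : ℝ) / N, ((y + j' : ℤ) : ℝ) / N, ((z + k' : ℤ) : ℝ) / N)‖ ≤ 1 / N := by
  have key (x i i' : ℤ) (hi : i ∈ Icc (0 : ℤ) 1) (hi' : i' ∈ Icc (0 : ℤ) 1) :
      ‖((x + i : ℤ) : ℝ) / N - ((x + i' : ℤ) : ℝ) / N‖ ≤ 1 / N := by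
    rw [← sub_div, norm_div, Real.norm_natCast]
    gcongr
    rw [Real.norm_eq_abs, abs_le]
    obtain ⟨h1, h2⟩ := hi
    obtain ⟨h3, h4⟩ := hi'
    constructor
    · have : -1 ≤ (x + i) - (x + i') := by omega
      exact_mod_cast this
    · have : (x + i) - (x + i') ≤ 1 := by omega
      exact_mod_cast this
  rw [Prod.mk_sub_mk, Prod.mk_sub_mk, Prod.norm_mk, Prod.norm_mk]
  exact sup_le (key x i i' hi hi') (sup_le (key y j j' hj hj') (key z k k' hk hk'))

/-- Compact support makes `H` uniformly continuous. Once `1 / N` is below the modulus for `1 / 3`,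
the labellings at times `s / N` and `(s + 1) / N` miss a common label on every cube, so the count is
constant along the `N` time steps. -/
theorem meshDegree_eq_of_homotopy {R : ℝ} (H : unitInterval × (ℝ × ℝ × ℝ) → S3)
    (hc : Continuous H) (hR : ∀ t x, R < ‖x‖ → H (t, x) = 1) :
    ∀ᶠ N in Filter.atTop,
      meshDegree N (fun x => H (0, x)) = meshDegree N (fun x => H (1, x)) := by
  have hsupp : HasCompactMulSupport H := by
    refine HasCompactMulSupport.intro (K := univ ×ˢ Metric.closedBall 0 R)
      (isCompact_univ.prod (isCompact_closedBall _ _)) fun p hp => ?_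
    refine hR p.1 p.2 ?_
    simpa using hp
  obtain ⟨δ, hδ, hd⟩ := Metric.uniformContinuous_iff.1
    (hsupp.uniformContinuous_of_continuous hc) (1 / 3) (by norm_num)
  obtain ⟨N₀, hN₀⟩ := exists_nat_gt (1 / δ)
  filter_upwards [Filter.eventually_ge_atTop (N₀ + 1)] with N hN
  have hNpos : 0 < N := by omega
  have hN' : (0 : ℝ) < N := by exact_mod_cast hNpos
  have hNδ : 1 / (N : ℝ) < δ := by
    rw [div_lt_comm₀ hN' hδ]
    refine hN₀.trans_le ?_
    exact_mod_cast (by omega : N₀ ≤ N)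
  have hmem (s : ℕ) (hs : s ≤ N) : (s : ℝ) / N ∈ unitInterval :=
    ⟨by positivity, by rw [div_le_one hN']; exact_mod_cast hs⟩
  have step (s : ℕ) (hs : s + 1 ≤ N) :
      meshDegree N (fun x => H (⟨_, hmem (s + 1) hs⟩, x)) =
        meshDegree N (fun x => H (⟨_, hmem s (by omega)⟩, x)) := by
    refine gridCount_eq_of_close (isTrivialOutside_label hNpos (hR _))
      (isTrivialOutside_label hNpos (hR _)) fun x y z => ?_
    obtain ⟨m, hm⟩ := S3.exists_label_ne (s := {q | ∃ t : unitInterval,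
      (t.1 = (s : ℝ) / N ∨ t.1 = ((s + 1 : ℕ) : ℝ) / N) ∧
      ∃ i ∈ Icc (0 : ℤ) 1, ∃ j ∈ Icc (0 : ℤ) 1, ∃ k ∈ Icc (0 : ℤ) 1,
      q = H (t, (((x + i : ℤ) : ℝ) / N, ((y + j : ℤ) : ℝ) / N, ((z + k : ℤ) : ℝ) / N))}) (by
      rintro _ ⟨t, ht, i, hi, j, hj, k, hk, rfl⟩ _ ⟨t', ht', i', hi', j', hj', k', hk', rfl⟩
      apply hd
      rw [Prod.dist_eq, max_lt_iff]
      constructor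
      · refine lt_of_le_of_lt ?_ hNδ
        rw [Subtype.dist_eq, Real.dist_eq]
        have h1 : ((s + 1 : ℕ) : ℝ) / N = (s : ℝ) / N + 1 / N := by push_cast; ring
        have h2 : 0 < 1 / (N : ℝ) := by positivity
        rw [abs_le]
        rcases ht with ht | ht <;> rcases ht' with ht' | ht' <;> rw [ht, ht'] <;>
          constructor <;> linarith
      · refine lt_of_le_of_lt ?_ hNδ
        rw [dist_eq_norm]
        exact norm_lattice_sub_le x y z hi hj hk hi' hj' hk')
    exact ⟨m, fun i hi j hj k hk => ⟨hm _ ⟨_, Or.inl rfl, i, hi, j, hj, k, hk, rfl⟩,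
      hm _ ⟨_, Or.inr rfl, i, hi, j, hj, k, hk, rfl⟩⟩⟩
  have all (s : ℕ) (hs : s ≤ N) :
      meshDegree N (fun x => H (⟨_, hmem s hs⟩, x)) = meshDegree N (fun x => H (0, x)) := by
    induction s with
    | zero =>
      have : (⟨_, hmem 0 hs⟩ : unitInterval) = 0 := Subtype.ext (by simp)
      rw [this]
    | succ s ih => rw [step s hs, ih (by omega)]
  have : (⟨_, hmem N le_rfl⟩ : unitInterval) = 1 := Subtype.ext (by simp [hN'.ne'])
  rw [← all N le_rfl, this]

theorem meshDegree_one (N : ℕ) : meshDegree N (fun _ => 1) = 0 := by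
  rw [meshDegree, gridCount]
  refine finsum_eq_zero_of_forall_eq_zero fun v => cubeCount_eq_zero ?_
  intros
  exact S3.label_one

/-- Since `φ` need not be multiplicative, `g` is first slid away by a homotopy until no cube meets
the supports of both factors; on each cube one factor is then `1`. -/
theorem meshDegree_mul {R : ℝ} {φ : S3 → S3} (hφ : Continuous φ) (hφ1 : φ 1 = 1)
    {f g : ℝ × ℝ × ℝ → S3} (hf : IsLoopMap R f) (hg : IsLoopMap R g) :
    ∀ᶠ N in Filter.atTop, meshDegree N (fun x => φ (f x * g x)) =
      meshDegree N (fun x => φ (f x)) + meshDegree N (fun x => φ (g x)) := by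
  -- Twice the radius separates the supports, and `1` bounds the mesh. An integral shift preserves
  -- the lattice.
  obtain ⟨T, hT⟩ := exists_nat_gt (2 * |R| + 1)
  have hfar (x : ℝ × ℝ × ℝ) (t : ℝ) (ht : t ∈ unitInterval) (hx : |R| + T < ‖x‖) :
      |R| < ‖x - (t * T, 0, 0)‖ := by
    have h1 := norm_sub_norm_le x (t * T, 0, 0)
    have h2 : ‖((t * T, 0, 0) : ℝ × ℝ × ℝ)‖ ≤ T := by
      have h3 : |t * (T : ℝ)| ≤ T := by
        rw [abs_of_nonneg (mul_nonneg ht.1 (Nat.cast_nonneg _))]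
        exact mul_le_of_le_one_left (Nat.cast_nonneg _) ht.2
      simpa [Prod.norm_mk] using h3
    linarith
  have hTR (x : ℝ × ℝ × ℝ) (hx : |R| + T < ‖x‖) : R < ‖x‖ := by
    have h1 := le_abs_self R
    have h2 : (0 : ℝ) ≤ T := Nat.cast_nonneg _
    linarith
  have hhom := meshDegree_eq_of_homotopy (R := |R| + T)
    (fun p => φ (f p.2 * g (p.2 - ((p.1 : ℝ) * T, 0, 0))))
    (by
      have := hf.continuous
      have := hg.continuous
      fun_prop)
    (fun t x hx => by
      simp only
      rw [hf.eq_one x (hTR x hx), hg.eq_one _ ((le_abs_self R).trans_lt (hfar x t t.2 hx)),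
        one_mul, hφ1])
  filter_upwards [hhom, Filter.eventually_ge_atTop 1] with N hN hN1
  have hNpos : 0 < N := by omega
  have hN' : (0 : ℝ) < N := by exact_mod_cast hNpos
  simp only [Icc.coe_zero, Icc.coe_one, zero_mul, one_mul] at hN
  have h0 : ((0, 0, 0) : ℝ × ℝ × ℝ) = 0 := rfl
  rw [h0] at hN
  simp only [sub_zero] at hN
  have htr : meshDegree N (fun x => φ (g (x - ((T : ℝ), 0, 0)))) =
      meshDegree N (fun x => φ (g x)) := by
    refine Eq.trans ?_ (gridCount_translate _ (T * N))
    rw [meshDegree]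
    congr 1
    ext x y z
    simp only [Prod.mk_sub_mk, sub_zero]
    congr 5
    push_cast
    field_simp
  rw [hN, ← htr]
  refine gridCount_eq_add (R := N * ⌈|R| + T⌉)
    (isTrivialOutside_label hNpos (f := fun x => φ (f x)) fun x hx => ?_)
    (isTrivialOutside_label hNpos (f := fun x => φ (g (x - ((T : ℝ), 0, 0)))) fun x hx => ?_)
    fun x y z => ?_
  · rw [hf.eq_one x (hTR x hx), hφ1]
  · have := hfar x 1 ⟨zero_le_one, le_rfl⟩ hx
    rw [one_mul] at this
    rw [hg.eq_one _ ((le_abs_self R).trans_lt this), hφ1]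
  -- Either `f` is `1` at all corners, or some corner lies within `R` of the origin and the whole
  -- cube avoids the support of the shifted `g`.
  by_cases hall : ∀ i ∈ Icc (0 : ℤ) 1, ∀ j ∈ Icc (0 : ℤ) 1, ∀ k ∈ Icc (0 : ℤ) 1,
      f (((x + i : ℤ) : ℝ) / N, ((y + j : ℤ) : ℝ) / N, ((z + k : ℤ) : ℝ) / N) = 1
  · refine Or.inl fun i hi j hj k hk => ?_
    simp only
    rw [hall i hi j hj k hk, hφ1, one_mul]
    exact ⟨S3.label_one, rfl⟩
  · refine Or.inr fun i hi j hj k hk => ?_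
    push Not at hall
    obtain ⟨i', hi', j', hj', k', hk', hne⟩ := hall
    have h1 := norm_lattice_sub_le (N := N) x y z hi hj hk hi' hj' hk'
    set p : ℝ × ℝ × ℝ :=
      (((x + i : ℤ) : ℝ) / N, ((y + j : ℤ) : ℝ) / N, ((z + k : ℤ) : ℝ) / N)
    set p' : ℝ × ℝ × ℝ :=
      (((x + i' : ℤ) : ℝ) / N, ((y + j' : ℤ) : ℝ) / N, ((z + k' : ℤ) : ℝ) / N)
    have h2 : ‖p'‖ ≤ R := by
      by_contra! h
      exact hne (hf.eq_one _ h)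
    have h3 : 1 / (N : ℝ) ≤ 1 := by
      rw [div_le_one hN']
      exact_mod_cast hN1
    have h4 : ‖p‖ ≤ ‖p - p'‖ + ‖p'‖ := by simpa using norm_add_le (p - p') p'
    have h5 : (T : ℝ) ≤ ‖((T, 0, 0) : ℝ × ℝ × ℝ)‖ := by simp [Prod.norm_mk]
    have h6 := norm_sub_norm_le ((T, 0, 0) : ℝ × ℝ × ℝ) p
    rw [norm_sub_rev] at h6
    have h7 := le_abs_self R
    simp only
    rw [hg.eq_one (p - ((T : ℝ), 0, 0)) (by linarith), hφ1, mul_one]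
    exact ⟨S3.label_one, rfl⟩

theorem IsLoopMap.zpow {R : ℝ} {f : ℝ × ℝ × ℝ → S3} (hf : IsLoopMap R f) (n : ℤ) :
    IsLoopMap R (fun x => f x ^ n) :=
  ⟨hf.continuous.zpow n, fun x hx => by rw [hf.eq_one x hx, one_zpow]⟩

theorem meshDegree_zpow {R : ℝ} {φ : S3 → S3} (hφ : Continuous φ) (hφ1 : φ 1 = 1)
    {f : ℝ × ℝ × ℝ → S3} (hf : IsLoopMap R f) (n : ℤ) :
    ∀ᶠ N in Filter.atTop,
      meshDegree N (fun x => φ (f x ^ n)) = n * meshDegree N (fun x => φ (f x)) := by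
  have hstep (m : ℤ) : ∀ᶠ N in Filter.atTop, meshDegree N (fun x => φ (f x ^ (m + 1))) =
      meshDegree N (fun x => φ (f x ^ m)) + meshDegree N (fun x => φ (f x)) := by
    simpa only [zpow_add_one] using meshDegree_mul hφ hφ1 (hf.zpow m) hf
  induction n with
  | zero =>
    refine Filter.Eventually.of_forall fun N => ?_
    simp [hφ1, meshDegree_one]
  | succ n ih =>
    filter_upwards [ih, hstep n] with N h1 h2
    rw [h2, h1]
    ring
  | pred n ih =>
    filter_upwards [ih, hstep (-n - 1)] with N h1 h2
    rw [sub_add_cancel, h1] at h2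
    linear_combination -h2

/-! ### A map of degree `-1`. -/

/-- An auxiliary nowhere vanishing map whose normalization is a map `ℝ³ → S³` of degree `±1`. -/
noncomputable def wrapVec (x : ℝ × ℝ × ℝ) : Quaternion ℝ :=
  ⟨2 * min ‖x‖ 1 - 1, x.1 * (1 - min ‖x‖ 1), x.2.1 * (1 - min ‖x‖ 1),
    x.2.2 * (1 - min ‖x‖ 1)⟩

theorem continuous_wrapVec : Continuous wrapVec := by
  have h : Continuous fun x : ℝ × ℝ × ℝ => (!₂[2 * min ‖x‖ 1 - 1, x.1 * (1 - min ‖x‖ 1),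
      x.2.1 * (1 - min ‖x‖ 1), x.2.2 * (1 - min ‖x‖ 1)] : EuclideanSpace ℝ (Fin 4)) := by
    refine (PiLp.continuous_toLp 2 _).comp (continuous_pi fun i => ?_)
    fin_cases i <;> simp <;> fun_prop
  exact Quaternion.linearIsometryEquivTuple.symm.continuous.comp h

theorem wrapVec_ne_zero (x : ℝ × ℝ × ℝ) : wrapVec x ≠ 0 := by
  intro h
  have h0 := congrArg QuaternionAlgebra.re h
  have h1 := congrArg QuaternionAlgebra.imI h
  have h2 := congrArg QuaternionAlgebra.imJ h
  have h3 := congrArg QuaternionAlgebra.imK h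
  simp only [wrapVec, Quaternion.re_zero, Quaternion.imI_zero, Quaternion.imJ_zero,
    Quaternion.imK_zero] at h0 h1 h2 h3
  have hm : min ‖x‖ 1 = 1 / 2 := by linarith
  rw [hm] at h1 h2 h3
  have hx : x = 0 := by
    ext
    · simpa using by linarith
    · simpa using by linarith
    · simpa using by linarith
  rw [hx] at hm
  norm_num at hm

/-- A map `ℝ³ → S³` of degree `±1`, equal to `1` outside of the unit ball. -/
noncomputable def wrap (x : ℝ × ℝ × ℝ) : S3 :=
  ⟨‖wrapVec x‖⁻¹ • wrapVec x, by simp [norm_smul, wrapVec_ne_zero x]⟩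

theorem isLoopMap_wrap : IsLoopMap 1 wrap where
  continuous := by
    refine Continuous.subtype_mk ?_ _
    exact (continuous_wrapVec.norm.inv₀ fun x => norm_ne_zero_iff.2 (wrapVec_ne_zero x)).smul
      continuous_wrapVec
  eq_one x hx := by
    have : wrapVec x = 1 := by
      ext <;> simp [wrapVec, min_eq_right hx.le, Quaternion.re_one, Quaternion.imI_one,
        Quaternion.imJ_one, Quaternion.imK_one]
      norm_num
    apply Subtype.ext
    simp [wrap, this]

-- Labels depend only on signs of coordinates, which positive factors preserve; no normalisation has
-- to be computed.
open Classical in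
theorem label_wrap (x : ℝ × ℝ × ℝ) (hx : ‖x‖ ≤ 1) : S3.label (wrap x) =
    if 1 / 2 < ‖x‖ then 4 else if 0 < x.1 then 0 else if 0 < x.2.1 then 1
      else if 0 < x.2.2 then 2 else 3 := by
  have hp : 0 < ‖wrapVec x‖⁻¹ := inv_pos.2 (norm_pos_iff.2 (wrapVec_ne_zero x))
  have h0 : 0 < (wrap x).1.re ↔ 1 / 2 < ‖x‖ := by
    simp only [wrap, Quaternion.re_smul, smul_eq_mul, mul_pos_iff_of_pos_left hp]
    simp only [wrapVec, min_eq_left hx]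
    constructor <;> intro h <;> linarith
  by_cases h : 1 / 2 < ‖x‖
  · rw [if_pos h, S3.label, if_pos (h0.2 h)]
  · have hr : 0 < 1 - ‖x‖ := by linarith
    rw [if_neg h, S3.label, if_neg (mt h0.1 h)]
    simp only [wrap, Quaternion.imI_smul, Quaternion.imJ_smul, Quaternion.imK_smul,
      smul_eq_mul, mul_pos_iff_of_pos_left hp]
    simp only [wrapVec, min_eq_left hx, mul_pos_iff_of_pos_right hr]

theorem label_wrap_of_lt {x : ℝ × ℝ × ℝ} (hx : 1 / 2 < ‖x‖) : S3.label (wrap x) = 4 := by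
  rcases le_or_gt ‖x‖ 1 with h | h
  · rw [label_wrap x h, if_pos hx]
  · rw [isLoopMap_wrap.eq_one x h, S3.label_one]

open Classical in
theorem label_wrap_eq (x : ℝ × ℝ × ℝ) : S3.label (wrap x) =
    if 1 / 2 < ‖x‖ then 4 else if 0 < x.1 then 0 else if 0 < x.2.1 then 1
      else if 0 < x.2.2 then 2 else 3 := by
  by_cases h : 1 / 2 < ‖x‖
  · rw [if_pos h, label_wrap_of_lt h]
  · exact label_wrap x (by linarith)

/-- Only the cube with base vertex at the origin carries all of `0, 1, 2, 3`; `2 ≤ N` keeps its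
corners clear of label `4`. Its one counted simplex `000, 001, 011, 111` has labels `3, 2, 1, 0`, an
even permutation, and enters `cubeCount` with a minus sign. -/
theorem meshDegree_wrap {N : ℕ} (hN : 2 ≤ N) : meshDegree N wrap = -1 := by
  classical
  have hN' : (2 : ℝ) ≤ N := by exact_mod_cast hN
  have hpos (a : ℤ) : 0 < (a : ℝ) / N ↔ 0 < a := by
    rw [div_pos_iff_of_pos_right (by linarith)]
    exact_mod_cast Iff.rfl
  rw [meshDegree, gridCount]
  simp only [label_wrap_eq, hpos]
  rw [finsum_eq_single _ (0, 0, 0)]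
  · have hn (a b c : ℤ) (ha : a ∈ Icc (0 : ℤ) 1) (hb : b ∈ Icc (0 : ℤ) 1)
        (hc : c ∈ Icc (0 : ℤ) 1) :
        ¬ 1 / 2 < ‖(((a : ℝ) / N, (b : ℝ) / N, (c : ℝ) / N) : ℝ × ℝ × ℝ)‖ := by
      have key (a : ℤ) (ha : a ∈ Icc (0 : ℤ) 1) : ‖(a : ℝ) / N‖ ≤ 1 / 2 := by
        have h0 : (0 : ℝ) ≤ a := by exact_mod_cast ha.1
        have h1 : (a : ℝ) ≤ 1 := by exact_mod_cast ha.2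
        rw [Real.norm_eq_abs, abs_of_nonneg (by positivity)]
        exact div_le_div₀ zero_le_one h1 two_pos hN'
      rw [not_lt, Prod.norm_mk, Prod.norm_mk]
      exact sup_le (key a ha) (sup_le (key b hb) (key c hc))
    rw [cubeCount_congr (w' := fun i j k => if 0 < i then 0 else if 0 < j then 1
      else if 0 < k then 2 else 3)]
    · simp only [cubeCount]
      decide
    · intro i hi j hj k hk
      simp only [zero_add]
      rw [if_neg (hn i j k hi hj hk)]
  · rintro ⟨x, y, z⟩ hv
    by_cases hx : x = 0
    · by_cases hy : y = 0
      · have hz : z ≠ 0 := by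
          rintro rfl
          exact hv (by rw [hx, hy])
        rcases hz.lt_or_gt with hz | hz
        · refine cubeCount_eq_zero_of_ne 2 fun i hi j hj k hk => ?_
          have : ¬ 0 < z + k := by have := hk.2; omega
          simp only [this, if_false]
          split_ifs <;> decide
        · refine cubeCount_eq_zero_of_ne 3 fun i hi j hj k hk => ?_
          have : 0 < z + k := by have := hk.1; omega
          simp only [this, if_true]
          split_ifs <;> decide
      · rcases Ne.lt_or_gt hy with hy | hy
        · refine cubeCount_eq_zero_of_ne 1 fun i hi j hj k hk => ?_
          have : ¬ 0 < y + j := by have := hj.2; omega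
          simp only [this, if_false]
          split_ifs <;> decide
        · refine cubeCount_eq_zero_of_ne 3 fun i hi j hj k hk => ?_
          have : 0 < y + j := by have := hj.1; omega
          simp only [this, if_true]
          split_ifs <;> decide
    · rcases Ne.lt_or_gt hx with hx | hx
      · refine cubeCount_eq_zero_of_ne 0 fun i hi j hj k hk => ?_
        have : ¬ 0 < x + i := by have := hi.2; omega
        simp only [this, if_false]
        split_ifs <;> decide
      · refine cubeCount_eq_zero_of_ne 3 fun i hi j hj k hk => ?_
        have : 0 < x + i := by have := hi.1; omega
        simp only [this, if_true]
        split_ifs <;> decide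

/-! ### The divisibility forced by a null-homotopy. -/

/-- If `q ↦ φ (q ^ n) * q ^ (-l)` is null-homotopic, then `n` divides `l`, the quotient being the
degree of `φ`. -/
theorem dvd_of_nullhomotopic (φ : C(S3, S3)) {n l : ℤ}
    (h : (⟨fun q => φ (q ^ n) * q ^ (-l), by fun_prop⟩ : C(S3, S3)).Nullhomotopic) : n ∣ l := by
  obtain ⟨c, ⟨H⟩⟩ := h
  have hφ := φ.continuous
  have hH := H.continuous
  have h0 (q : S3) : H (0, q) = φ (q ^ n) * q ^ (-l) := H.apply_zero q
  have h1 (q : S3) : H (1, q) = c := H.apply_one q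
  set ψ : S3 → S3 := fun q => (φ 1)⁻¹ * φ q with hψ
  have hψc : Continuous ψ := continuous_const.mul hφ
  have hψ1 : ψ 1 = 1 := inv_mul_cancel _
  have hw := isLoopMap_wrap
  have hwc := hw.continuous
  -- `H` may move the base point; dividing by `H (t, 1)` gives a homotopy from `ψ (wrap ^ n) * wrap
  -- ^ (-l)` to the constant `1` that stays `1` outside the ball.
  have hnull := meshDegree_eq_of_homotopy (R := 1)
    (fun p => (H (p.1, 1))⁻¹ * H (p.1, wrap p.2)) (by fun_prop) (fun t x hx => by
      simp only
      rw [hw.eq_one x hx, inv_mul_cancel])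
  have hl : IsLoopMap 1 fun x => ψ (wrap x ^ n) := by
    refine ⟨hψc.comp (hw.zpow n).continuous, fun x hx => ?_⟩
    rw [hw.eq_one x hx, one_zpow, hψ1]
  have hmul := meshDegree_mul continuous_id rfl hl (hw.zpow (-l))
  have hpow := meshDegree_zpow hψc hψ1 hw n
  have hpow' := meshDegree_zpow continuous_id rfl hw (-l)
  obtain ⟨N, e0, e1, e2, e3, hN⟩ :=
    (hnull.and (hmul.and (hpow.and (hpow'.and (Filter.eventually_ge_atTop 2))))).exists
  have h1' (q : S3) : (H (1, 1))⁻¹ * H (1, q) = 1 := by rw [h1, h1, inv_mul_cancel]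
  simp only [h0, h1', meshDegree_one, one_zpow, mul_one] at e0
  simp only [id_eq, ← mul_assoc, hψ] at e0 e1 e2 e3
  rw [e0, e2, e3, meshDegree_wrap hN] at e1
  -- The minus sign compensates for the degree `-1` of `wrap`.
  exact ⟨-meshDegree N fun x => (φ 1)⁻¹ * φ (wrap x), by linear_combination -e1⟩

/-! ### Meridians of `S⁴` and the clutching map in the total space. -/

namespace S4

/-- The point of height `s` on the meridian of `S⁴` through the point `q` of the equator. -/
noncomputable def meridian (s : Icc (-1 : ℝ) 1) (q : S3) : S4 :=
  ⟨WithLp.toLp 2 (√(1 - s.1 ^ 2) • q.1, s.1), by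
    have hs : 0 ≤ 1 - s.1 ^ 2 := by nlinarith [s.2.1, s.2.2]
    have hq : ‖q.1‖ = 1 := by simp
    rw [mem_sphere_zero_iff_norm, ← sq_eq_sq₀ (norm_nonneg _) zero_le_one,
      WithLp.prod_norm_sq_eq_of_L2]
    simp [norm_smul, hq, Real.sq_sqrt hs]⟩

theorem continuous_meridian :
    Continuous fun p : Icc (-1 : ℝ) 1 × S3 => meridian p.1 p.2 := by
  refine Continuous.subtype_mk ((WithLp.prod_continuous_toLp 2 _ _).comp ?_) _
  fun_prop

theorem toEquator_meridian_zero (q : S3) :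
    toEquator (meridian ⟨0, by simp⟩ q) = q := by
  have hq : ‖q.1‖ = 1 := by simp
  have h0 : q.1 ≠ 0 := norm_ne_zero_iff.1 (by rw [hq]; exact one_ne_zero)
  simp [toEquator, meridian, h0, hq]

theorem meridian_one (q : S3) : meridian ⟨1, by simp⟩ q = meridian ⟨1, by simp⟩ 1 := by
  simp [meridian]

theorem meridian_neg_one (q : S3) : meridian ⟨-1, by simp⟩ q = meridian ⟨-1, by simp⟩ 1 := by
  simp [meridian]

end S4

section ClutchingBundle

variable {G : Type} [Group G] [TopologicalSpace G] [IsTopologicalGroup G]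

/-- The point of the bundle with clutching map `f` that lies over `x` and has the fibre coordinate
`a` in the chart `i`. -/
noncomputable def chartPoint (f : C(S3, G)) (i : Bool) (x : S4) (a : G) : ClutchingBundle f :=
  ((clutchingCore f).localTriv i).toOpenPartialHomeomorph.symm (x, a)

theorem continuousOn_chartPoint (f : C(S3, G)) (i : Bool) :
    ContinuousOn (fun p : S4 × G => chartPoint f i p.1 p.2) (S4.chart i ×ˢ univ) :=
  ((clutchingCore f).localTriv i).toOpenPartialHomeomorph.continuousOn_symm

theorem continuous_chartPoint_comp (f : C(S3, G)) (i : Bool) {Y : Type*} [TopologicalSpace Y]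
    {u : Y → S4} {v : Y → G} (hu : Continuous u) (hv : Continuous v)
    (h : ∀ y, u y ∈ S4.chart i) : Continuous fun y => chartPoint f i (u y) (v y) :=
  (continuousOn_chartPoint f i).comp_continuous (hu.prodMk hv) fun y => ⟨h y, mem_univ _⟩

theorem chartPoint_true_eq (f : C(S3, G)) {x : S4} (h : x ∈ S4.chart true)
    (h' : x ∈ S4.chart false) (a : G) :
    chartPoint f true x a = chartPoint f false x (f x.toEquator * a) := by
  rw [chartPoint, chartPoint, FiberBundleCore.localTriv_symm_apply,
    FiberBundleCore.localTriv_symm_apply]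
  congr 1
  exact ((clutchingCore f).coordChange_comp true false _ x
    ⟨⟨h, h'⟩, (clutchingCore f).mem_baseSet_at x⟩ a).symm

/-- Transition functions act on the left, so they commute with right translation. -/
theorem op_smul_chartPoint (f : C(S3, G)) (i : Bool) (x : S4) (a g : G) :
    MulOpposite.op g • chartPoint f i x a = chartPoint f i x (a * g) := by
  rw [chartPoint, chartPoint, FiberBundleCore.localTriv_symm_apply,
    FiberBundleCore.localTriv_symm_apply]
  change (⟨x, clutchingTransition f i _ x * a * g⟩ : ClutchingBundle f) =
    ⟨x, clutchingTransition f i _ x * (a * g)⟩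
  rw [mul_assoc]

/-- The south pole of `S⁴`. -/
noncomputable def southPole : S4 := S4.meridian ⟨-1, by simp⟩ 1

theorem southPole_mem_chart : southPole ∈ S4.chart false := by
  change (-1 : ℝ) ≠ 1
  norm_num

theorem continuous_chartPoint_southPole (f : C(S3, G)) :
    Continuous (chartPoint f false southPole) :=
  continuous_chartPoint_comp f false continuous_const continuous_id fun _ => southPole_mem_chart

/-- The clutching map becomes null-homotopic in the total space. -/
theorem nullhomotopic_of_clutching {X : Type} [TopologicalSpace X] (f : C(S3, G))
    (F : C(ClutchingBundle f, X)) :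
    (⟨fun q => F (chartPoint f false southPole (f q)),
      F.continuous.comp ((continuous_chartPoint_southPole f).comp f.continuous)⟩ :
      C(S3, X)).Nullhomotopic := by
  have hsouth : Continuous fun p : unitInterval × S3 =>
      S4.meridian ⟨p.1 - 1, by linarith [p.1.2.1], by linarith [p.1.2.2]⟩ p.2 :=
    S4.continuous_meridian.comp ((Continuous.subtype_mk (by fun_prop) _).prodMk continuous_snd)
  have hnorth : Continuous fun p : unitInterval × S3 =>
      S4.meridian ⟨p.1, by linarith [p.1.2.1], p.1.2.2⟩ p.2 :=
    S4.continuous_meridian.comp ((Continuous.subtype_mk (by fun_prop) _).prodMk continuous_snd)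
  have csouth : Continuous fun p : unitInterval × S3 =>
      F (chartPoint f false (S4.meridian ⟨p.1 - 1, by linarith [p.1.2.1], by linarith [p.1.2.2]⟩ p.2)
        (f p.2)) :=
    F.continuous.comp (continuous_chartPoint_comp f false hsouth (by fun_prop) fun p => by
      change (p.1 : ℝ) - 1 ≠ 1
      linarith [p.1.2.2])
  have cnorth : Continuous fun p : unitInterval × S3 =>
      F (chartPoint f true (S4.meridian ⟨p.1, by linarith [p.1.2.1], p.1.2.2⟩ p.2) 1) :=
    F.continuous.comp (continuous_chartPoint_comp f true hnorth (by fun_prop) fun p => by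
      change (p.1 : ℝ) ≠ -1
      linarith [p.1.2.1])
  let mid : C(S3, X) := ⟨fun q => F (chartPoint f true (S4.meridian ⟨0, by simp⟩ q) 1), by
    have := cnorth.comp (Continuous.prodMk_right (0 : unitInterval))
    exact this⟩
  -- Move along meridians from the south pole to the equator with southern coordinate `f q`. There
  -- the northern coordinate is `1`; keeping it up to the north pole makes the dependence on `q`
  -- disappear.
  refine ⟨F (chartPoint f true (S4.meridian ⟨1, by simp⟩ 1) 1),
    ContinuousMap.Homotopic.trans (g := mid) ⟨⟨⟨_, csouth⟩, fun q => ?_, fun q => ?_⟩⟩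
      ⟨⟨⟨_, cnorth⟩, fun q => ?_, fun q => ?_⟩⟩⟩
  · simp only [Icc.coe_zero, zero_sub, ContinuousMap.coe_mk]
    rw [S4.meridian_neg_one]
    rfl
  · simp only [Icc.coe_one, sub_self, ContinuousMap.coe_mk, mid]
    rw [chartPoint_true_eq, S4.toEquator_meridian_zero, mul_one]
    · change (0 : ℝ) ≠ -1
      norm_num
    · change (0 : ℝ) ≠ 1
      norm_num
  · rfl
  · simp only [Icc.coe_one, ContinuousMap.const_apply]
    rw [S4.meridian_one]

end ClutchingBundle

/-! ### Conclusion. -/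

/-- If the diagonal bundle is trivial, then `k + l` divides `l`. -/
theorem add_dvd_of_isTrivialPrincipal {k l : ℤ}
    (h : IsTrivialPrincipal diagonalS3 (projM k l)) : k + l ∣ l := by
  obtain ⟨e, -, he⟩ := h
  set F : C(PBundle k l, S3) := ⟨fun p => (e p).2.1.1, by fun_prop⟩ with hF
  have hFmul (p : PBundle k l) (g : S3) : F (MulOpposite.op (g, g) • p) = F p * g :=
    congrArg (fun x : diagonalS3 => x.1.1) (he p ⟨(g, g), ⟨g, rfl⟩⟩)
  let φ : C(S3, S3) := ⟨fun a => F (chartPoint (powerClutching k l) false southPole (a, 1)),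
    F.continuous.comp ((continuous_chartPoint_southPole _).comp (by fun_prop))⟩
  refine dvd_of_nullhomotopic φ ?_
  convert nullhomotopic_of_clutching (powerClutching k l) F using 1
  ext1 q
  change F _ * q ^ (-l) = F _
  -- Equivariance absorbs the factor `(q^(-l), q^(-l))` of the clutching map.
  rw [← hFmul, op_smul_chartPoint]
  congr 2
  simp [powerClutching, zpow_add]

theorem lemma6p3 (k l : ℤ) (hkl : k * l ≠ 0)
    (htriv : IsTrivialPrincipal diagonalS3 (projM k l)) :
    k + l ≠ 0 ∧ ∃ m : ℤ, (k : ℚ) / ((k : ℚ) + (l : ℚ)) = (m : ℚ) := by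
  obtain ⟨d, hd⟩ := add_dvd_of_isTrivialPrincipal htriv
  have hne : k + l ≠ 0 := by
    intro h0
    rw [h0, zero_mul] at hd
    exact hkl (by rw [hd, mul_zero])
  refine ⟨hne, 1 - d, ?_⟩
  have hne' : (k : ℚ) + l ≠ 0 := by exact_mod_cast hne
  have hd' : (l : ℚ) = (k + l) * d := by exact_mod_cast hd
  rw [div_eq_iff hne']
  push_cast
  linear_combination -hd'
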